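/- Theorem (Lower bounds for the entropy and entropy rate). Let $H\in(0,1)$ and let $B^H=\{B^H_t,\ t\ge 0\}$ be a fractional Brownian motion with Hurst index $H$, i.e. a centered Gaussian process with covariance $$\mathsf E\,B^H_tB^H_s=\tfrac12\bigl(t^{2H}+s^{2H}-|t-s|^{2H}\bigr),\qquad s,t\ge 0.$$ Let $G^H_k=B^H_k-B^H_{k-1}$, $k=1,2,\dots$, be the fractional Gaussian noise, and put $$\sigma_H^2=\frac{\Gamma\left(\frac32-H\right)}{\Gamma\left(H+\frac12\right)\Gamma(2-2H)},\qquad \sigma_H=\sqrt{\sigma_H^2}.$$ For an absolutely continuous random vector $\xi$ in $\mathbb R^n$ with density $p$, let $\mathbf H(\xi)=-\int_{\mathbb R^n}p(x)\log p(x)\,dx$ (natural logarithm) denote its differential entropy. Then for every $n\ge 1$ the vector $(G^H_1,\dots,G^H_n)$ is absolutely continuous with a well-defined finite entropy, and $$\mathbf H(G^H_1,\dots,G^H_n)\ \ge\ \frac n2\Bigl(1+\log(2\pi)+\log\sigma_H^2\Bigr).$$ Moreover, the entropy rate $\mathbf H_\infty(G^H)=\lim_{n\to\infty}\frac1n\mathbf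 H(G^H_1,\dots,G^H_n)$ exists as a finite limit and satisfies $$\mathbf H_\infty(G^H)\ \ge\ \frac{1+\log(2\pi)}2+\log\sigma_H .$$ -/

import Mathlib

open MeasureTheory ProbabilityTheory Filter Topology
open scoped NNReal

/-- `B` is a (one-sided) fractional Brownian motion with Hurst index `H` under `P`: a centered
Gaussian process `(B t)`, `t ≥ 0`, with covariance
`E[B t * B s] = (t ^ (2H) + s ^ (2H) - |t - s| ^ (2H)) / 2`. -/
structure IsFractionalBrownianMotion {Ω : Type*} [MeasurableSpace Ω]
    (H : ℝ) (B : ℝ≥0 → Ω → ℝ) (P : Measure Ω) : Prop where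
  isGaussianProcess : IsGaussianProcess B P
  centered : ∀ t, ∫ ω, B t ω ∂P = 0
  covariance : ∀ t s, ∫ ω, B t ω * B s ω ∂P =
    1 / 2 * ((t : ℝ) ^ (2 * H) + (s : ℝ) ^ (2 * H) - |(t : ℝ) - (s : ℝ)| ^ (2 * H))

/-- The unit increments of `B`. Sequences are indexed from `0` here, so the value at `k` is
`G_{k+1} = B_{k+1} - B_k`, the `(k+1)`-st term of the noise `G_1, G_2, …`. -/
def fractionalGaussianNoise {Ω : Type*} (B : ℝ≥0 → Ω → ℝ) (k : ℕ) (ω : Ω) : ℝ :=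
  B ((k : ℝ≥0) + 1) ω - B (k : ℝ≥0) ω

/-- The random vector formed by the first `n` terms of a sequence of random variables. -/
def initialVector {Ω : Type*} (X : ℕ → Ω → ℝ) (n : ℕ) (ω : Ω) : Fin n → ℝ :=
  fun i => X i ω

/-- The density with respect to Lebesgue measure of a random vector, as a real function. -/
noncomputable def realDensity {Ω : Type*} [MeasurableSpace Ω] {n : ℕ}
    (ξ : Ω → Fin n → ℝ) (P : Measure Ω) (x : Fin n → ℝ) : ℝ :=
  (pdf ξ P volume x).toReal

/-- The random vector `ξ` is absolutely continuous and the integral that defines its entropy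
converges absolutely. -/
def HasEntropy {Ω : Type*} [MeasurableSpace Ω] {n : ℕ}
    (ξ : Ω → Fin n → ℝ) (P : Measure Ω) : Prop :=
  HasPDF ξ P volume ∧
    Integrable (fun x => realDensity ξ P x * Real.log (realDensity ξ P x)) volume

/-- The (differential) entropy `-∫ p(x) log p(x) dx` of a random vector with density `p`. -/
noncomputable def entropy {Ω : Type*} [MeasurableSpace Ω] {n : ℕ}
    (ξ : Ω → Fin n → ℝ) (P : Measure Ω) : ℝ :=
  -∫ x, realDensity ξ P x * Real.log (realDensity ξ P x)

/-- `h` is the entropy rate of the sequence `X`: the limit of the entropies of its initial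
vectors divided by their lengths, these entropies being well defined. -/
def IsEntropyRate {Ω : Type*} [MeasurableSpace Ω]
    (X : ℕ → Ω → ℝ) (P : Measure Ω) (h : ℝ) : Prop :=
  (∀ n : ℕ, 1 ≤ n → HasEntropy (initialVector X n) P) ∧
    Tendsto (fun n : ℕ => entropy (initialVector X n) P / n) atTop (𝓝 h)

/-- The constant `σ_H² = Γ(3/2 - H) / (Γ(H + 1/2) Γ(2 - 2H))`. -/
noncomputable def sigmaSq (H : ℝ) : ℝ :=
  Real.Gamma (3 / 2 - H) / (Real.Gamma (H + 1 / 2) * Real.Gamma (2 - 2 * H))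

/-- The constant `σ_H`, the positive square root of `σ_H²`. -/
noncomputable def sigma (H : ℝ) : ℝ :=
  Real.sqrt (sigmaSq H)

/-!
A Gaussian vector with covariance matrix `S` has entropy `n / 2 * (1 + log (2π)) + log (det S) / 2`,
so everything is about the Toeplitz determinants `det T_n` of the autocovariance of the noise. The
ratio `det T_{n+1} / det T_n` is the minimum of the quadratic form of `T_{n+1}` over the vectors
with first coordinate `1`. It decreases in `n`, since padding a vector with a zero does not change
the form; hence `log (det T_n) / n` is a Cesàro mean of a decreasing sequence, and it only remains
to bound all the ratios below by `σ_H²`.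

For this the noise is written as a moving average of white noise with the Mandelbrot–Van Ness
kernel, which turns the quadratic form at `v` into the squared `L²` norm of `∑ i, v i * f (s - i)`.
As `f` vanishes for `s ≤ 0`, on `(0, 1]` this sum is just `f s` when `v 0 = 1`. There
`f s ^ 2 = 2 H σ_H² s ^ (2 H - 1)`, whose integral over `(0, 1]` is exactly `σ_H²`.
-/

section BetaIntegral

variable {p q : ℝ}

theorem integral_Ioo_rpow_mul_one_sub_rpow (hp : 0 < p) (hq : 0 < q) :
    ∫ t in Set.Ioo (0 : ℝ) 1, t ^ (p - 1) * (1 - t) ^ (q - 1) = beta p q := by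
  have cast_integrand : Set.EqOn
      (fun t : ℝ => (t : ℂ) ^ ((p : ℂ) - 1) * (1 - (t : ℂ)) ^ ((q : ℂ) - 1))
      (fun t => ((t ^ (p - 1) * (1 - t) ^ (q - 1) : ℝ) : ℂ)) (Set.Ioc 0 1) := by
    intro t ht
    push_cast
    rw [Complex.ofReal_cpow ht.1.le, Complex.ofReal_cpow (sub_nonneg.2 ht.2)]
    push_cast
    rfl
  rw [beta_eq_betaIntegralReal p q hp hq, Complex.betaIntegral,
    intervalIntegral.integral_of_le zero_le_one,
    setIntegral_congr_fun measurableSet_Ioc cast_integrand, integral_complex_ofReal,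
    Complex.ofReal_re, integral_Ioc_eq_integral_Ioo]

theorem image_div_one_add_Ioi : (fun x : ℝ => x / (1 + x)) '' Set.Ioi 0 = Set.Ioo 0 1 := by
  ext t
  constructor
  · rintro ⟨x, hx : 0 < x, rfl⟩
    exact ⟨by positivity, (div_lt_one (by positivity)).2 (by linarith)⟩
  · rintro ⟨ht0, ht1⟩
    have : 0 < 1 - t := sub_pos.2 ht1
    refine ⟨t / (1 - t), div_pos ht0 this, ?_⟩
    field_simp
    ring

theorem hasDerivAt_div_one_add {x : ℝ} (hx : 1 + x ≠ 0) :
    HasDerivAt (fun x : ℝ => x / (1 + x)) (1 / (1 + x) ^ 2) x := by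
  convert! (hasDerivAt_id x).div ((hasDerivAt_id x).const_add 1) hx using 1
  simp

theorem injOn_div_one_add_Ioi : Set.InjOn (fun x : ℝ => x / (1 + x)) (Set.Ioi 0) := by
  intro x (hx : 0 < x) y (hy : 0 < y) hxy
  rw [div_eq_div_iff (by positivity) (by positivity)] at hxy
  linarith

theorem integral_Ioi_rpow_mul_one_add_rpow (hp : 0 < p) (hq : 0 < q) :
    ∫ x in Set.Ioi (0 : ℝ), x ^ (p - 1) * (1 + x) ^ (-(p + q)) = beta p q := by
  have substituted_integrand : Set.EqOn (fun x : ℝ => x ^ (p - 1) * (1 + x) ^ (-(p + q)))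
      (fun x => |1 / (1 + x) ^ 2| • ((x / (1 + x)) ^ (p - 1) * (1 - x / (1 + x)) ^ (q - 1)))
      (Set.Ioi 0) := by
    intro x (hx : 0 < x)
    have hx1 : 0 < 1 + x := by positivity
    have one_sub : 1 - x / (1 + x) = (1 + x)⁻¹ := by field_simp; ring
    have exponent : -(p + q) = -(p - 1) + -(q - 1) - (2 : ℕ) := by push_cast; ring
    simp only [smul_eq_mul]
    rw [one_sub, abs_of_pos (by positivity), Real.div_rpow hx.le hx1.le, Real.inv_rpow hx1.le,
      exponent, Real.rpow_sub_natCast hx1.ne', Real.rpow_add hx1, Real.rpow_neg hx1.le,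
      Real.rpow_neg hx1.le]
    ring
  rw [setIntegral_congr_fun measurableSet_Ioi substituted_integrand,
    ← integral_image_eq_integral_abs_deriv_smul measurableSet_Ioi
      (fun x (hx : 0 < x) => (hasDerivAt_div_one_add (by positivity)).hasDerivWithinAt)
      injOn_div_one_add_Ioi (fun t : ℝ => t ^ (p - 1) * (1 - t) ^ (q - 1)),
    image_div_one_add_Ioi, integral_Ioo_rpow_mul_one_sub_rpow hp hq]

theorem integrableOn_Ioi_rpow_mul_one_add_rpow (hp : 0 < p) (hq : 0 < q) :
    IntegrableOn (fun x : ℝ => x ^ (p - 1) * (1 + x) ^ (-(p + q))) (Set.Ioi 0) :=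
  .of_integral_ne_zero <| by
    rw [integral_Ioi_rpow_mul_one_add_rpow hp hq]
    exact (beta_pos hp hq).ne'

end BetaIntegral

section RpowIncrement

variable {a x : ℝ}

theorem abs_one_add_rpow_sub_one_le (hx : 0 ≤ x) (ha : |a| ≤ 1) : |(1 + x) ^ a - 1| ≤ x := by
  obtain ⟨ha0, ha1⟩ := abs_le.1 ha
  have hx1 : 1 ≤ 1 + x := by linarith
  have upper : (1 + x) ^ a ≤ 1 + x := by
    simpa using Real.rpow_le_rpow_of_exponent_le hx1 ha1
  have lower : 1 - x ≤ (1 + x) ^ a := calc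
    1 - x ≤ (1 + x)⁻¹ := by
      rw [inv_eq_one_div, le_div_iff₀ (by linarith)]
      nlinarith
    _ ≤ (1 + x) ^ a := by
      simpa [Real.rpow_neg_one] using Real.rpow_le_rpow_of_exponent_le hx1 ha0
  rw [abs_le]
  constructor <;> linarith

theorem abs_one_add_rpow_sub_rpow_le (hx : 0 < x) (ha : |a| ≤ 1) :
    |(1 + x) ^ a - x ^ a| ≤ x ^ (a - 1) := by
  have factor : (1 + x) ^ a - x ^ a = x ^ a * ((1 + x⁻¹) ^ a - 1) := by
    rw [mul_sub_one, ← Real.mul_rpow hx.le (by positivity), mul_one_add,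
      mul_inv_cancel₀ hx.ne', add_comm x]
  rw [factor, abs_mul, abs_of_pos (Real.rpow_pos_of_pos hx a), Real.rpow_sub_one hx.ne',
    div_eq_mul_inv]
  gcongr
  exact abs_one_add_rpow_sub_one_le (by positivity) ha

theorem sq_rpow (hx : 0 < x) (a : ℝ) : (x ^ a) ^ 2 = x ^ (2 * a) := by
  rw [← Real.rpow_mul_natCast hx.le, mul_comm]
  norm_cast

theorem integrableOn_Ioc_sq_rpow (ha : -(1 / 2) < a) :
    IntegrableOn (fun s : ℝ => (s ^ a) ^ 2) (Set.Ioc 0 1) := by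
  have intervalIntegrable :=
    intervalIntegral.intervalIntegrable_rpow' (a := 0) (b := 1) (r := 2 * a) (by linarith)
  rw [intervalIntegrable_iff_integrableOn_Ioc_of_le zero_le_one] at intervalIntegrable
  exact intervalIntegrable.congr_fun (fun s hs => (sq_rpow hs.1 a).symm) measurableSet_Ioc

theorem integral_Ioc_sq_rpow (ha : -(1 / 2) < a) :
    ∫ s in Set.Ioc (0 : ℝ) 1, (s ^ a) ^ 2 = 1 / (2 * a + 1) := by
  rw [setIntegral_congr_fun measurableSet_Ioc fun s hs => sq_rpow hs.1 a,
    ← intervalIntegral.integral_of_le zero_le_one, integral_rpow (Or.inl (by linarith)),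
    Real.one_rpow, Real.zero_rpow (by linarith), sub_zero]

theorem integrableOn_Ioc_sq_one_add_rpow_sub_rpow (ha : -(1 / 2) < a) :
    IntegrableOn (fun x : ℝ => ((1 + x) ^ a - x ^ a) ^ 2) (Set.Ioc 0 1) := by
  have continuous_part : ContinuousOn (fun x : ℝ => (1 + x) ^ a) (Set.Icc 0 1) := fun x hx =>
    ((continuousAt_const.add continuousAt_id).rpow_const
      (Or.inl (show (1 : ℝ) + x ≠ 0 by linarith [hx.1]))).continuousWithinAt
  have memLp_one_add : MemLp (fun x : ℝ => (1 + x) ^ a) 2 (volume.restrict (Set.Ioc 0 1)) :=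
    (memLp_two_iff_integrable_sq (Measurable.aestronglyMeasurable (by fun_prop))).2
      ((continuous_part.pow 2).integrableOn_Icc.mono_set Set.Ioc_subset_Icc_self)
  have memLp_rpow : MemLp (fun x : ℝ => x ^ a) 2 (volume.restrict (Set.Ioc 0 1)) :=
    (memLp_two_iff_integrable_sq (Measurable.aestronglyMeasurable (by fun_prop))).2
      (integrableOn_Ioc_sq_rpow ha)
  exact (memLp_one_add.sub memLp_rpow).integrable_sq

theorem integrableOn_Ioi_one_sq_one_add_rpow_sub_rpow (ha : |a| < 1 / 2) :
    IntegrableOn (fun x : ℝ => ((1 + x) ^ a - x ^ a) ^ 2) (Set.Ioi 1) := by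
  have dominating : IntegrableOn (fun x : ℝ => x ^ (2 * (a - 1))) (Set.Ioi 1) :=
    integrableOn_Ioi_rpow_of_lt (by linarith [(abs_lt.1 ha).2]) one_pos
  refine dominating.mono' (by fun_prop) ?_
  filter_upwards [ae_restrict_mem measurableSet_Ioi] with x (hx : 1 < x)
  have hx0 : 0 < x := by positivity
  rw [Real.norm_of_nonneg (sq_nonneg _), ← sq_abs, ← sq_rpow hx0]
  gcongr
  exact abs_one_add_rpow_sub_rpow_le hx0 (by linarith)

theorem integrableOn_Ioi_sq_one_add_rpow_sub_rpow (ha : |a| < 1 / 2) :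
    IntegrableOn (fun x : ℝ => ((1 + x) ^ a - x ^ a) ^ 2) (Set.Ioi 0) := by
  rw [← Set.Ioc_union_Ioi_eq_Ioi zero_le_one]
  exact (integrableOn_Ioc_sq_one_add_rpow_sub_rpow (abs_lt.1 ha).1).union
    (integrableOn_Ioi_one_sq_one_add_rpow_sub_rpow ha)

/-- An antiderivative of `(2 a + 1) ((1 + x) ^ a - x ^ a) ^ 2` up to a multiple of the beta
integrand `x ^ a (1 + x) ^ (a - 2)`. The last summand comes from an integration by parts of
`x ^ a (1 + x) ^ (a - 1)`, which is not integrable at infinity when `0 ≤ a`. -/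
noncomputable def rpowIncrementPrimitive (a x : ℝ) : ℝ :=
  (1 + x) ^ (2 * a + 1) + x ^ (2 * a + 1) - 2 * (x ^ (a + 1) * (1 + x) ^ a) -
    x ^ (a + 1) * (1 + x) ^ (a - 1)

theorem hasDerivAt_rpowIncrementPrimitive (hx : 0 < x) :
    HasDerivAt (rpowIncrementPrimitive a)
      ((2 * a + 1) * ((1 + x) ^ a - x ^ a) ^ 2 - (1 - a) * (x ^ a * (1 + x) ^ (a - 2))) x := by
  have hx1 : 0 < 1 + x := by positivity
  have deriv_rpow (r : ℝ) : HasDerivAt (fun y : ℝ => y ^ r) (r * x ^ (r - 1)) x :=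
    Real.hasDerivAt_rpow_const (Or.inl hx.ne')
  have deriv_one_add_rpow (r : ℝ) :
      HasDerivAt (fun y : ℝ => (1 + y) ^ r) (r * (1 + x) ^ (r - 1)) x := by
    simpa using ((hasDerivAt_id x).const_add 1).rpow_const (p := r) (Or.inl hx1.ne')
  convert! (((deriv_one_add_rpow (2 * a + 1)).add (deriv_rpow (2 * a + 1))).sub
    (((deriv_rpow (a + 1)).mul (deriv_one_add_rpow a)).const_mul 2)).sub
      ((deriv_rpow (a + 1)).mul (deriv_one_add_rpow (a - 1))) using 1
  have exponent : a - 2 = a - 1 - 1 := by ring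
  rw [exponent]
  simp only [add_sub_cancel_right, Real.rpow_sub_one hx1.ne', Real.rpow_add_one hx.ne',
    ← sq_rpow hx, ← sq_rpow hx1]
  field_simp
  ring

theorem rpowIncrementPrimitive_eq (hx : 0 < x) :
    rpowIncrementPrimitive a x = x * ((1 + x) ^ a - x ^ a) ^ 2 +
      (1 + x) ^ a * ((1 + x) ^ a - x ^ a) + (1 + x) ^ a * x ^ a / (1 + x) := by
  have hx1 : 0 < 1 + x := by positivity
  rw [rpowIncrementPrimitive, Real.rpow_add_one hx.ne', Real.rpow_add_one hx.ne',
    Real.rpow_add_one hx1.ne', Real.rpow_sub_one hx1.ne', ← sq_rpow hx, ← sq_rpow hx1]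
  field_simp
  ring

theorem abs_rpowIncrementPrimitive_le (ha : |a| ≤ 1) (hx : 1 ≤ x) :
    |rpowIncrementPrimitive a x| ≤ 5 * x ^ (2 * a - 1) := by
  have hx0 : 0 < x := by linarith
  have increment_le : |(1 + x) ^ a - x ^ a| ≤ x ^ a / x :=
    (abs_one_add_rpow_sub_rpow_le hx0 ha).trans_eq (Real.rpow_sub_one hx0.ne' a)
  rw [rpowIncrementPrimitive_eq hx0, Real.rpow_sub_one hx0.ne', ← sq_rpow hx0]
  have hb : 0 < x ^ a := Real.rpow_pos_of_pos hx0 a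
  have hA : 0 < (1 + x) ^ a := Real.rpow_pos_of_pos (by positivity) a
  generalize x ^ a = b at *
  generalize (1 + x) ^ a = A at *
  have A_le : A ≤ 2 * b := by linarith [le_abs_self (A - b), div_le_self hb.le hx]
  calc |x * (A - b) ^ 2 + A * (A - b) + A * b / (1 + x)|
      ≤ |x * (A - b) ^ 2| + |A * (A - b)| + |A * b / (1 + x)| := abs_add_three _ _ _
    _ = x * |A - b| ^ 2 + A * |A - b| + A * b / (1 + x) := by
        rw [abs_mul, abs_mul, abs_pow, abs_of_pos hx0, abs_of_pos hA,
          abs_of_pos (show 0 < A * b / (1 + x) by positivity)]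
    _ ≤ x * (b / x) ^ 2 + 2 * b * (b / x) + 2 * b * b / x := by gcongr; linarith
    _ = 5 * (b ^ 2 / x) := by field_simp; ring

theorem tendsto_rpowIncrementPrimitive_atTop (ha : |a| < 1 / 2) :
    Tendsto (rpowIncrementPrimitive a) atTop (𝓝 0) := by
  have bound : ∀ᶠ x : ℝ in atTop,
      ‖rpowIncrementPrimitive a x‖ ≤ 5 * x ^ (-(1 - 2 * a)) := by
    filter_upwards [eventually_ge_atTop 1] with x hx
    simpa using abs_rpowIncrementPrimitive_le (by linarith) hx
  refine squeeze_zero_norm' bound ?_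
  simpa using (tendsto_rpow_neg_atTop (y := 1 - 2 * a) (by linarith [(abs_lt.1 ha).2])).const_mul 5

theorem continuousAt_rpowIncrementPrimitive_zero (ha : -(1 / 2) < a) :
    ContinuousAt (rpowIncrementPrimitive a) 0 := by
  have one_add_rpow (r : ℝ) : ContinuousAt (fun y : ℝ => (1 + y) ^ r) 0 :=
    (continuousAt_const.add continuousAt_id).rpow_const (Or.inl (by simp))
  have rpow {r : ℝ} (hr : 0 < r) : ContinuousAt (fun y : ℝ => y ^ r) 0 :=
    Real.continuousAt_rpow_const _ _ (Or.inr hr.le)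
  have h1 : 0 < 2 * a + 1 := by linarith
  have h2 : 0 < a + 1 := by linarith
  exact (((one_add_rpow _).add (rpow h1)).sub
    (((rpow h2).mul (one_add_rpow _)).const_mul 2)).sub ((rpow h2).mul (one_add_rpow _))

theorem rpowIncrementPrimitive_zero (ha : -(1 / 2) < a) : rpowIncrementPrimitive a 0 = 1 := by
  simp [rpowIncrementPrimitive, Real.zero_rpow (show 2 * a + 1 ≠ 0 by linarith),
    Real.zero_rpow (show a + 1 ≠ 0 by linarith)]

theorem integral_Ioi_sq_one_add_rpow_sub_rpow (ha : |a| < 1 / 2) :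
    ∫ x in Set.Ioi (0 : ℝ), ((1 + x) ^ a - x ^ a) ^ 2 =
      (Real.Gamma (a + 1) * Real.Gamma (1 - 2 * a) / Real.Gamma (1 - a) - 1) / (2 * a + 1) := by
  obtain ⟨ha0, ha1⟩ := abs_lt.1 ha
  have hp : 0 < a + 1 := by linarith
  have hq : 0 < 1 - 2 * a := by linarith
  have beta_integrand : (fun x : ℝ => x ^ (a + 1 - 1) * (1 + x) ^ (-(a + 1 + (1 - 2 * a)))) =
      fun x => x ^ a * (1 + x) ^ (a - 2) := by
    funext x
    congr 2 <;> ring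
  have integrable_beta := integrableOn_Ioi_rpow_mul_one_add_rpow hp hq
  have integral_beta := integral_Ioi_rpow_mul_one_add_rpow hp hq
  rw [beta_integrand] at integrable_beta integral_beta
  have integrable_sq := integrableOn_Ioi_sq_one_add_rpow_sub_rpow ha
  have ftc := integral_Ioi_of_hasDerivAt_of_tendsto
    (continuousAt_rpowIncrementPrimitive_zero ha0).continuousWithinAt
    (fun x hx => hasDerivAt_rpowIncrementPrimitive hx)
    ((integrable_sq.const_mul (2 * a + 1)).sub (integrable_beta.const_mul (1 - a)))
    (tendsto_rpowIncrementPrimitive_atTop ha)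
  rw [integral_sub (integrable_sq.const_mul _) (integrable_beta.const_mul _), integral_const_mul,
    integral_const_mul, integral_beta, rpowIncrementPrimitive_zero ha0] at ftc
  have gamma_sum : Real.Gamma (a + 1 + (1 - 2 * a)) = (1 - a) * Real.Gamma (1 - a) := by
    rw [← Real.Gamma_add_one (by linarith)]
    ring_nf
  have one_sub_ne : 1 - a ≠ 0 := by linarith
  rw [beta, gamma_sum, mul_div_assoc', mul_div_mul_left _ _ one_sub_ne] at ftc
  rw [eq_div_iff (by linarith : 2 * a + 1 ≠ 0)]
  linarith

end RpowIncrement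

section TruncatedPower

variable {a : ℝ}

/-- The truncated power function `s ↦ s₊ ^ a`, equal to `0` on `(-∞, 0]` for every `a`. -/
noncomputable def truncPow (a s : ℝ) : ℝ := if 0 < s then s ^ a else 0

theorem truncPow_of_pos {s : ℝ} (hs : 0 < s) : truncPow a s = s ^ a := if_pos hs

theorem truncPow_of_nonpos {s : ℝ} (hs : s ≤ 0) : truncPow a s = 0 := if_neg hs.not_gt

theorem truncPow_mul {c : ℝ} (hc : 0 < c) (s : ℝ) : truncPow a (c * s) = c ^ a * truncPow a s := by
  rcases le_or_gt s 0 with hs | hs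
  · rw [truncPow_of_nonpos hs, truncPow_of_nonpos (mul_nonpos_of_nonneg_of_nonpos hc.le hs),
      mul_zero]
  · rw [truncPow_of_pos hs, truncPow_of_pos (mul_pos hc hs), Real.mul_rpow hc.le hs.le]

@[fun_prop]
theorem measurable_truncPow : Measurable (truncPow a) :=
  Measurable.ite measurableSet_Ioi (by fun_prop) measurable_const

/-- The unit increment `s₊ ^ a - (s - 1)₊ ^ a` of the truncated power function. -/
noncomputable def truncPowIncrement (a s : ℝ) : ℝ := truncPow a s - truncPow a (s - 1)

@[fun_prop]
theorem measurable_truncPowIncrement : Measurable (truncPowIncrement a) := by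
  unfold truncPowIncrement
  fun_prop

theorem truncPowIncrement_of_nonpos {s : ℝ} (hs : s ≤ 0) : truncPowIncrement a s = 0 := by
  rw [truncPowIncrement, truncPow_of_nonpos hs, truncPow_of_nonpos (by linarith), sub_zero]

theorem truncPowIncrement_of_mem_Ioc {s : ℝ} (hs : s ∈ Set.Ioc 0 1) :
    truncPowIncrement a s = s ^ a := by
  rw [truncPowIncrement, truncPow_of_pos hs.1, truncPow_of_nonpos (sub_nonpos.2 hs.2), sub_zero]

theorem truncPowIncrement_add_one {x : ℝ} (hx : 0 < x) :
    truncPowIncrement a (x + 1) = (1 + x) ^ a - x ^ a := by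
  rw [truncPowIncrement, add_sub_cancel_right, truncPow_of_pos (by positivity), truncPow_of_pos hx,
    add_comm]

theorem setIntegral_Ioc_sq_truncPowIncrement (ha : -(1 / 2) < a) :
    ∫ s in Set.Ioc (0 : ℝ) 1, truncPowIncrement a s ^ 2 = 1 / (2 * a + 1) := by
  rw [← integral_Ioc_sq_rpow ha]
  exact setIntegral_congr_fun measurableSet_Ioc fun s hs => by
    rw [truncPowIncrement_of_mem_Ioc hs]

theorem preimage_add_one_Ioi : (fun x : ℝ => x + 1) ⁻¹' Set.Ioi 1 = Set.Ioi 0 := by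
  ext
  simp

theorem integrableOn_Ioc_sq_truncPowIncrement (ha : -(1 / 2) < a) :
    IntegrableOn (fun s => truncPowIncrement a s ^ 2) (Set.Ioc 0 1) :=
  (integrableOn_Ioc_sq_rpow ha).congr_fun
    (fun s hs => by rw [truncPowIncrement_of_mem_Ioc hs]) measurableSet_Ioc

theorem integrableOn_Ioi_sq_truncPowIncrement (ha : |a| < 1 / 2) :
    IntegrableOn (fun s => truncPowIncrement a s ^ 2) (Set.Ioi 1) := by
  rw [← (measurePreserving_add_right volume (1 : ℝ)).integrableOn_comp_preimage
    (measurableEmbedding_addRight 1), preimage_add_one_Ioi]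
  exact (integrableOn_Ioi_sq_one_add_rpow_sub_rpow ha).congr_fun
    (fun x hx => by simp only [Function.comp_apply, truncPowIncrement_add_one hx])
    measurableSet_Ioi

theorem setIntegral_Ioi_sq_truncPowIncrement :
    ∫ s in Set.Ioi (1 : ℝ), truncPowIncrement a s ^ 2 =
      ∫ x in Set.Ioi (0 : ℝ), ((1 + x) ^ a - x ^ a) ^ 2 := by
  rw [← (measurePreserving_add_right volume (1 : ℝ)).setIntegral_preimage_emb
    (measurableEmbedding_addRight 1), preimage_add_one_Ioi]
  exact setIntegral_congr_fun measurableSet_Ioi fun x hx => by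
    rw [truncPowIncrement_add_one hx]

theorem support_sq_truncPowIncrement_subset :
    Function.support (fun s => truncPowIncrement a s ^ 2) ⊆ Set.Ioi 0 :=
  Function.support_subset_iff'.2 fun s hs => by
    rw [truncPowIncrement_of_nonpos (not_lt.1 hs), zero_pow two_ne_zero]

theorem integrable_sq_truncPowIncrement (ha : |a| < 1 / 2) :
    Integrable (fun s => truncPowIncrement a s ^ 2) := by
  rw [← integrableOn_iff_integrable_of_support_subset support_sq_truncPowIncrement_subset,
    ← Set.Ioc_union_Ioi_eq_Ioi zero_le_one]
  exact (integrableOn_Ioc_sq_truncPowIncrement (abs_lt.1 ha).1).union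
    (integrableOn_Ioi_sq_truncPowIncrement ha)

theorem integral_sq_truncPowIncrement (ha : |a| < 1 / 2) :
    ∫ s, truncPowIncrement a s ^ 2 =
      Real.Gamma (a + 1) * Real.Gamma (1 - 2 * a) / Real.Gamma (1 - a) / (2 * a + 1) := by
  have ha0 := (abs_lt.1 ha).1
  rw [← setIntegral_eq_integral_of_forall_compl_eq_zero
      (Function.support_subset_iff'.1 support_sq_truncPowIncrement_subset),
    ← Set.Ioc_union_Ioi_eq_Ioi zero_le_one,
    setIntegral_union (Set.Ioc_disjoint_Ioi le_rfl) measurableSet_Ioi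
      (integrableOn_Ioc_sq_truncPowIncrement ha0) (integrableOn_Ioi_sq_truncPowIncrement ha),
    setIntegral_Ioc_sq_truncPowIncrement ha0, setIntegral_Ioi_sq_truncPowIncrement,
    integral_Ioi_sq_one_add_rpow_sub_rpow ha]
  ring

theorem sq_truncPow_sub_truncPow {u v : ℝ} (huv : u < v) (s : ℝ) :
    (truncPow a (s - u) - truncPow a (s - v)) ^ 2 =
      (v - u) ^ (2 * a) * truncPowIncrement a ((s - u) / (v - u)) ^ 2 := by
  have hc : 0 < v - u := sub_pos.2 huv
  have scale_left : s - u = (v - u) * ((s - u) / (v - u)) := by field_simp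
  have scale_right : s - v = (v - u) * ((s - u) / (v - u) - 1) := by field_simp; ring
  rw [← sq_rpow hc, ← mul_pow, truncPowIncrement, mul_sub, ← truncPow_mul hc, ← truncPow_mul hc,
    ← scale_left, ← scale_right]

theorem memLp_truncPow_sub_truncPow (ha : |a| < 1 / 2) (u v : ℝ) :
    MemLp (fun s => truncPow a (s - u) - truncPow a (s - v)) 2 := by
  wlog huv : u ≤ v generalizing u v
  · simpa only [Pi.neg_def, neg_sub] using (this v u (le_of_not_ge huv)).neg
  rcases huv.eq_or_lt with rfl | huv
  · simp
  rw [memLp_two_iff_integrable_sq (Measurable.aestronglyMeasurable (by fun_prop))]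
  simp only [sq_truncPow_sub_truncPow huv]
  exact (((integrable_sq_truncPowIncrement ha).comp_div (sub_pos.2 huv).ne').comp_sub_right
    u).const_mul _

theorem integral_sq_truncPow_sub_truncPow (ha : |a| < 1 / 2) (u v : ℝ) :
    ∫ s, (truncPow a (s - u) - truncPow a (s - v)) ^ 2 =
      |u - v| ^ (2 * a + 1) * ∫ s, truncPowIncrement a s ^ 2 := by
  wlog huv : u ≤ v generalizing u v
  · simpa only [sub_sq_comm, abs_sub_comm v u] using this v u (le_of_not_ge huv)
  rcases huv.eq_or_lt with rfl | huv
  · simp [Real.zero_rpow (show 2 * a + 1 ≠ 0 by linarith [(abs_lt.1 ha).1])]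
  have hc : 0 < v - u := sub_pos.2 huv
  simp only [sq_truncPow_sub_truncPow huv]
  rw [integral_const_mul,
    integral_sub_right_eq_self (fun s => truncPowIncrement a (s / (v - u)) ^ 2) u,
    Measure.integral_comp_div (fun s => truncPowIncrement a s ^ 2), abs_sub_comm u v, abs_of_pos hc,
    smul_eq_mul, Real.rpow_add_one hc.ne', mul_assoc]

end TruncatedPower

section Toeplitz

open scoped Matrix

/-- The `n × n` Toeplitz matrix with entries `γ (i - j)`; for the autocovariance function `γ` of a
stationary sequence it is the covariance matrix of `n` consecutive terms. -/
def toeplitz {R : Type*} (γ : ℤ → R) (n : ℕ) : Matrix (Fin n) (Fin n) R :=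
  Matrix.of fun i j => γ ((i : ℤ) - j)

theorem toeplitz_apply {R : Type*} (γ : ℤ → R) (n : ℕ) (i j : Fin n) :
    toeplitz γ n i j = γ ((i : ℤ) - j) := rfl

theorem submatrix_succ_toeplitz {R : Type*} (γ : ℤ → R) (n : ℕ) :
    (toeplitz γ (n + 1)).submatrix Fin.succ Fin.succ = toeplitz γ n := by
  ext i j
  simp [toeplitz_apply]

theorem snoc_dotProduct_toeplitz_mulVec_snoc {R : Type*} [NonUnitalNonAssocSemiring R]
    (γ : ℤ → R) {n : ℕ} (v : Fin n → R) :
    (Fin.snoc (α := fun _ => R) v 0) ⬝ᵥ toeplitz γ (n + 1) *ᵥ (Fin.snoc (α := fun _ => R) v 0) =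
      v ⬝ᵥ toeplitz γ n *ᵥ v := by
  simp [dotProduct, Matrix.mulVec, Fin.sum_univ_castSucc, toeplitz_apply]

theorem inv_zero_zero_eq_det_submatrix_succ_div_det {K : Type*} [Field K] {n : ℕ}
    (A : Matrix (Fin (n + 1)) (Fin (n + 1)) K) :
    A⁻¹ 0 0 = (A.submatrix Fin.succ Fin.succ).det / A.det := by
  rw [Matrix.inv_def, Matrix.smul_apply, Matrix.adjugate_fin_succ_eq_det_submatrix]
  simp [Fin.succAbove_zero, div_eq_inv_mul]

theorem isLeast_dotProduct_mulVec_of_apply_eq_one {ι : Type*} [Fintype ι] [DecidableEq ι]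
    {A : Matrix ι ι ℝ} (hA : A.PosDef) (i : ι) :
    IsLeast ((fun v => v ⬝ᵥ A *ᵥ v) '' {v | v i = 1}) (A⁻¹ i i)⁻¹ := by
  have hdiag : A⁻¹ i i ≠ 0 := hA.inv.diag_pos.ne'
  set w : ι → ℝ := (A⁻¹ i i)⁻¹ • A⁻¹ *ᵥ Pi.single i 1 with hw
  have w_apply : w i = 1 := by simp [hw, hdiag]
  have A_mulVec_w : A *ᵥ w = (A⁻¹ i i)⁻¹ • Pi.single i 1 := by
    rw [hw, Matrix.mulVec_smul, Matrix.mulVec_mulVec,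
      Matrix.mul_nonsing_inv _ ((Matrix.isUnit_iff_isUnit_det A).1 hA.isUnit), Matrix.one_mulVec]
  have dotProduct_A_w {v : ι → ℝ} (hv : v i = 1) : v ⬝ᵥ A *ᵥ w = (A⁻¹ i i)⁻¹ := by
    simp [A_mulVec_w, hv]
  refine ⟨⟨w, w_apply, dotProduct_A_w w_apply⟩, ?_⟩
  rintro - ⟨v, hv, rfl⟩
  have symm : w ⬝ᵥ A *ᵥ v = v ⬝ᵥ A *ᵥ w := by
    rw [Matrix.dotProduct_mulVec, ← Matrix.mulVec_transpose,
      ← Matrix.conjTranspose_eq_transpose_of_trivial, hA.isHermitian.eq, dotProduct_comm]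
  have nonneg : 0 ≤ (v - w) ⬝ᵥ A *ᵥ (v - w) := by
    simpa using hA.posSemidef.dotProduct_mulVec_nonneg (v - w)
  rw [Matrix.mulVec_sub, dotProduct_sub, sub_dotProduct, sub_dotProduct, symm, dotProduct_A_w hv,
    dotProduct_A_w w_apply] at nonneg
  linarith

/-- The mean square error of the best linear prediction of a term of a stationary sequence with
autocovariance function `γ` from its `n` neighbours on one side, written as a ratio of
consecutive Toeplitz determinants. -/
noncomputable def innovationVariance (γ : ℤ → ℝ) (n : ℕ) : ℝ :=
  (toeplitz γ (n + 1)).det / (toeplitz γ n).det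

variable {γ : ℤ → ℝ}

theorem isLeast_innovationVariance {n : ℕ} (hγ : (toeplitz γ (n + 1)).PosDef) :
    IsLeast ((fun v => v ⬝ᵥ toeplitz γ (n + 1) *ᵥ v) '' {v | v 0 = 1})
      (innovationVariance γ n) := by
  convert isLeast_dotProduct_mulVec_of_apply_eq_one hγ 0 using 1
  rw [inv_zero_zero_eq_det_submatrix_succ_div_det, inv_div, submatrix_succ_toeplitz,
    innovationVariance]

theorem antitone_innovationVariance (hγ : ∀ n, (toeplitz γ n).PosDef) :
    Antitone (innovationVariance γ) := by
  refine antitone_nat_of_succ_le fun n => ?_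
  obtain ⟨v, hv, hmin⟩ := (isLeast_innovationVariance (hγ (n + 1))).1
  refine (isLeast_innovationVariance (hγ (n + 2))).2
    ⟨Fin.snoc (α := fun _ => ℝ) v 0, ?_, (snoc_dotProduct_toeplitz_mulVec_snoc γ v).trans hmin⟩
  rw [Set.mem_ofPred_eq, ← Fin.castSucc_zero, Fin.snoc_castSucc]
  exact hv

theorem log_det_toeplitz_eq_sum (hγ : ∀ n, (toeplitz γ n).PosDef) (n : ℕ) :
    Real.log (toeplitz γ n).det = ∑ k ∈ Finset.range n, Real.log (innovationVariance γ k) := by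
  have log_innovationVariance (k : ℕ) : Real.log (innovationVariance γ k) =
      Real.log (toeplitz γ (k + 1)).det - Real.log (toeplitz γ k).det :=
    Real.log_div (hγ (k + 1)).det_pos.ne' (hγ k).det_pos.ne'
  simp only [log_innovationVariance]
  rw [Finset.sum_range_sub fun k => Real.log (toeplitz γ k).det, Matrix.det_fin_zero, Real.log_one,
    sub_zero]

theorem mul_log_le_log_det_toeplitz (hγ : ∀ n, (toeplitz γ n).PosDef) {c : ℝ} (hc : 0 < c)
    (hcγ : ∀ n, c ≤ innovationVariance γ n) (n : ℕ) :
    n * Real.log c ≤ Real.log (toeplitz γ n).det := by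
  rw [log_det_toeplitz_eq_sum hγ]
  simpa using Finset.card_nsmul_le_sum (Finset.range n) _ _ fun k _ =>
    Real.log_le_log hc (hcγ k)

theorem exists_tendsto_log_det_toeplitz_div (hγ : ∀ n, (toeplitz γ n).PosDef) {c : ℝ} (hc : 0 < c)
    (hcγ : ∀ n, c ≤ innovationVariance γ n) :
    ∃ l, Real.log c ≤ l ∧
      Tendsto (fun n : ℕ => Real.log (toeplitz γ n).det / n) atTop (𝓝 l) := by
  have log_le (n : ℕ) : Real.log c ≤ Real.log (innovationVariance γ n) :=
    Real.log_le_log hc (hcγ n)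
  have antitone_log : Antitone fun n => Real.log (innovationVariance γ n) := fun _ n hmn =>
    Real.log_le_log (hc.trans_le (hcγ n)) (antitone_innovationVariance hγ hmn)
  refine ⟨_, le_ciInf log_le,
    (tendsto_atTop_ciInf antitone_log ⟨_, Set.forall_mem_range.2 log_le⟩).cesaro.congr fun n => ?_⟩
  rw [log_det_toeplitz_eq_sum hγ, div_eq_inv_mul]

end Toeplitz

section MovingAverage

open scoped Matrix

variable {f : ℝ → ℝ}

/-- The autocovariance at integer lag `k` of the moving averages `∫ f (s - j) dW(s)`, `j ∈ ℤ`, of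
white noise `dW` with kernel `f`. -/
noncomputable def movingAverageAutocov (f : ℝ → ℝ) (k : ℤ) : ℝ := ∫ s, f s * f (s + k)

theorem movingAverageAutocov_neg (f : ℝ → ℝ) (k : ℤ) :
    movingAverageAutocov f (-k) = movingAverageAutocov f k := by
  rw [movingAverageAutocov, ← integral_add_right_eq_self _ (k : ℝ)]
  simp [movingAverageAutocov, mul_comm]

theorem integral_comp_sub_mul_comp_sub (f : ℝ → ℝ) (i j : ℤ) :
    ∫ s, f (s - i) * f (s - j) = movingAverageAutocov f (i - j) := by
  rw [← integral_add_right_eq_self _ (i : ℝ)]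
  simp [movingAverageAutocov, add_sub_assoc]

theorem integral_sq_sum_mul_comp_sub (hf : MemLp f 2) {n : ℕ} (v : Fin n → ℝ) :
    ∫ s, (∑ i, v i * f (s - (i : ℕ))) ^ 2 = v ⬝ᵥ toeplitz (movingAverageAutocov f) n *ᵥ v := by
  have translate (i : Fin n) : MemLp (fun s => f (s - (i : ℕ))) 2 :=
    hf.comp_measurePreserving (measurePreserving_sub_right volume _)
  have integrable_term (i j : Fin n) :
      Integrable fun s => v i * v j * (f (s - (i : ℕ)) * f (s - (j : ℕ))) :=
    ((translate i).integrable_mul (translate j)).const_mul _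
  have expand (s : ℝ) : (∑ i, v i * f (s - (i : ℕ))) ^ 2 =
      ∑ i, ∑ j, v i * v j * (f (s - (i : ℕ)) * f (s - (j : ℕ))) := by
    rw [sq, Finset.sum_mul_sum]
    exact Finset.sum_congr rfl fun i _ => Finset.sum_congr rfl fun j _ => mul_mul_mul_comm ..
  have integral_term (i j : Fin n) : ∫ s, f (s - (i : ℕ)) * f (s - (j : ℕ)) =
      movingAverageAutocov f ((i : ℤ) - j) := by
    exact_mod_cast integral_comp_sub_mul_comp_sub f i j
  simp only [expand]
  rw [integral_finsetSum _ fun i _ => integrable_finsetSum _ fun j _ => integrable_term i j]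
  simp only [integral_finsetSum _ fun j _ => integrable_term _ j, integral_const_mul, integral_term,
    dotProduct, Matrix.mulVec, toeplitz_apply, Finset.mul_sum]
  exact Finset.sum_congr rfl fun i _ => Finset.sum_congr rfl fun j _ => by ring

theorem sum_mul_comp_sub_eq_of_mem_Ioc (hf0 : ∀ s ≤ 0, f s = 0) {n : ℕ} {v : Fin n → ℝ}
    {k : Fin n} (hv : ∀ i < k, v i = 0) {s : ℝ} (hs : s ∈ Set.Ioc ((k : ℕ) : ℝ) ((k : ℕ) + 1)) :
    ∑ i, v i * f (s - (i : ℕ)) = v k * f (s - (k : ℕ)) := by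
  refine Finset.sum_eq_single k (fun i _ hik => ?_) (by simp)
  rcases hik.lt_or_gt with hlt | hgt
  · rw [hv i hlt, zero_mul]
  · have : ((k : ℕ) : ℝ) + 1 ≤ (i : ℕ) := by exact_mod_cast hgt
    rw [hf0 _ (by linarith [hs.2]), mul_zero]

theorem sq_mul_setIntegral_le_dotProduct_toeplitz_mulVec (hf : MemLp f 2)
    (hf0 : ∀ s ≤ 0, f s = 0) {n : ℕ} {v : Fin n → ℝ} {k : Fin n} (hv : ∀ i < k, v i = 0) :
    v k ^ 2 * ∫ s in Set.Ioc (0 : ℝ) 1, f s ^ 2 ≤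
      v ⬝ᵥ toeplitz (movingAverageAutocov f) n *ᵥ v := by
  have integrable_sq : Integrable fun s => (∑ i, v i * f (s - (i : ℕ))) ^ 2 :=
    (memLp_finsetSum Finset.univ fun i _ =>
      (hf.comp_measurePreserving (measurePreserving_sub_right volume _)).const_mul
        (v i)).integrable_sq
  calc v k ^ 2 * ∫ s in Set.Ioc (0 : ℝ) 1, f s ^ 2
      = ∫ s in Set.Ioc ((k : ℕ) : ℝ) ((k : ℕ) + 1), (v k * f (s - (k : ℕ))) ^ 2 := by
        simp only [← integral_const_mul, ← mul_pow]
        simpa using (measurePreserving_add_right volume ((k : ℕ) : ℝ)).setIntegral_preimage_emb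
          (measurableEmbedding_addRight _) (fun s => (v k * f (s - (k : ℕ))) ^ 2)
          (Set.Ioc (k : ℕ) ((k : ℕ) + 1))
    _ = ∫ s in Set.Ioc ((k : ℕ) : ℝ) ((k : ℕ) + 1), (∑ i, v i * f (s - (i : ℕ))) ^ 2 :=
        setIntegral_congr_fun measurableSet_Ioc fun s hs => by
          rw [sum_mul_comp_sub_eq_of_mem_Ioc hf0 hv hs]
    _ ≤ ∫ s, (∑ i, v i * f (s - (i : ℕ))) ^ 2 :=
        setIntegral_le_integral integrable_sq (ae_of_all _ fun _ => sq_nonneg _)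
    _ = v ⬝ᵥ toeplitz (movingAverageAutocov f) n *ᵥ v := integral_sq_sum_mul_comp_sub hf v

theorem exists_apply_ne_zero_and_forall_lt_eq_zero {ι M : Type*} [LinearOrder ι] [WellFoundedLT ι]
    [Zero M] {v : ι → M} (hv : v ≠ 0) : ∃ k, v k ≠ 0 ∧ ∀ i < k, v i = 0 := by
  obtain ⟨k, hk, hmin⟩ := WellFounded.has_min (wellFounded_lt (α := ι)) (Function.support v)
    (Function.support_nonempty_iff.2 hv)
  exact ⟨k, hk, fun i hik => by_contra fun hi => hmin i hi hik⟩

theorem posDef_toeplitz_movingAverageAutocov (hf : MemLp f 2) (hf0 : ∀ s ≤ 0, f s = 0)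
    (hpos : 0 < ∫ s in Set.Ioc (0 : ℝ) 1, f s ^ 2) (n : ℕ) :
    (toeplitz (movingAverageAutocov f) n).PosDef := by
  refine .of_dotProduct_mulVec_pos ?_ fun v hv => ?_
  · ext i j
    simp only [Matrix.conjTranspose_apply, toeplitz_apply, star_trivial]
    rw [← movingAverageAutocov_neg, neg_sub]
  · obtain ⟨k, hk, hlt⟩ := exists_apply_ne_zero_and_forall_lt_eq_zero hv
    rw [star_trivial]
    exact (by positivity : 0 < v k ^ 2 * ∫ s in Set.Ioc (0 : ℝ) 1, f s ^ 2).trans_le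
      (sq_mul_setIntegral_le_dotProduct_toeplitz_mulVec hf hf0 hlt)

theorem setIntegral_sq_le_innovationVariance (hf : MemLp f 2) (hf0 : ∀ s ≤ 0, f s = 0)
    (hpos : 0 < ∫ s in Set.Ioc (0 : ℝ) 1, f s ^ 2) (n : ℕ) :
    ∫ s in Set.Ioc (0 : ℝ) 1, f s ^ 2 ≤ innovationVariance (movingAverageAutocov f) n := by
  obtain ⟨v, hv, hmin⟩ :=
    (isLeast_innovationVariance (posDef_toeplitz_movingAverageAutocov hf hf0 hpos (n + 1))).1
  have le_quadratic_form := sq_mul_setIntegral_le_dotProduct_toeplitz_mulVec hf hf0 (v := v)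
    (k := 0) fun i hi => absurd hi (Fin.not_lt_zero i)
  rw [show v 0 = 1 from hv, one_pow, one_mul] at le_quadratic_form
  exact le_quadratic_form.trans_eq hmin

end MovingAverage

section MandelbrotVanNess

theorem integral_truncPow_sub_mul_truncPow_sub {a : ℝ} (ha : |a| < 1 / 2) (u v x y : ℝ) :
    ∫ s, (truncPow a (s - u) - truncPow a (s - v)) * (truncPow a (s - x) - truncPow a (s - y)) =
      1 / 2 * (|u - y| ^ (2 * a + 1) + |v - x| ^ (2 * a + 1) - |u - x| ^ (2 * a + 1) -
        |v - y| ^ (2 * a + 1)) * ∫ s, truncPowIncrement a s ^ 2 := by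
  have integrable_sq (p q : ℝ) :
      Integrable fun s => (truncPow a (s - p) - truncPow a (s - q)) ^ 2 :=
    (memLp_truncPow_sub_truncPow ha p q).integrable_sq
  have polarization (s : ℝ) :
      (truncPow a (s - u) - truncPow a (s - v)) * (truncPow a (s - x) - truncPow a (s - y)) =
        1 / 2 * (((truncPow a (s - u) - truncPow a (s - y)) ^ 2 +
            (truncPow a (s - v) - truncPow a (s - x)) ^ 2) -
          ((truncPow a (s - u) - truncPow a (s - x)) ^ 2 +
            (truncPow a (s - v) - truncPow a (s - y)) ^ 2)) := by
    ring
  simp only [polarization]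
  rw [integral_const_mul, integral_sub ((integrable_sq u y).fun_add (integrable_sq v x))
      ((integrable_sq u x).fun_add (integrable_sq v y)),
    integral_add (integrable_sq u y) (integrable_sq v x),
    integral_add (integrable_sq u x) (integrable_sq v y)]
  simp only [integral_sq_truncPow_sub_truncPow ha]
  ring

/-- The autocovariance function of fractional Gaussian noise with Hurst index `H`. -/
noncomputable def noiseAutocov (H : ℝ) (k : ℤ) : ℝ :=
  1 / 2 * (|(k : ℝ) + 1| ^ (2 * H) + |(k : ℝ) - 1| ^ (2 * H) - 2 * |(k : ℝ)| ^ (2 * H))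

/-- The kernel of the Mandelbrot–Van Ness representation of fractional Gaussian noise as a moving
average of white noise, normalised to unit variance. Time is reversed, so that the kernel vanishes
on the negative half-line. -/
noncomputable def mandelbrotVanNessKernel (H s : ℝ) : ℝ :=
  √(2 * H * sigmaSq H) * truncPowIncrement (H - 1 / 2) s

theorem mandelbrotVanNessKernel_of_nonpos (H : ℝ) {s : ℝ} (hs : s ≤ 0) :
    mandelbrotVanNessKernel H s = 0 := by
  rw [mandelbrotVanNessKernel, truncPowIncrement_of_nonpos hs, mul_zero]

variable {H : ℝ}

theorem sigmaSq_pos (hH0 : 0 < H) (hH1 : H < 1) : 0 < sigmaSq H :=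
  div_pos (Real.Gamma_pos_of_pos (by linarith))
    (mul_pos (Real.Gamma_pos_of_pos (by linarith)) (Real.Gamma_pos_of_pos (by linarith)))

theorem abs_sub_half_lt_half (hH0 : 0 < H) (hH1 : H < 1) : |H - 1 / 2| < 1 / 2 :=
  abs_lt.2 ⟨by linarith, by linarith⟩

theorem integral_sq_truncPowIncrement_sub_half (hH0 : 0 < H) (hH1 : H < 1) :
    ∫ s, truncPowIncrement (H - 1 / 2) s ^ 2 = (2 * H * sigmaSq H)⁻¹ := by
  rw [integral_sq_truncPowIncrement (abs_sub_half_lt_half hH0 hH1), sigmaSq,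
    show H - 1 / 2 + 1 = H + 1 / 2 by ring, show 1 - 2 * (H - 1 / 2) = 2 - 2 * H by ring,
    show 1 - (H - 1 / 2) = 3 / 2 - H by ring, show 2 * (H - 1 / 2) + 1 = 2 * H by ring,
    mul_inv, inv_div, div_eq_inv_mul]

theorem memLp_mandelbrotVanNessKernel (hH0 : 0 < H) (hH1 : H < 1) :
    MemLp (mandelbrotVanNessKernel H) 2 :=
  ((memLp_two_iff_integrable_sq measurable_truncPowIncrement.aestronglyMeasurable).2
    (integrable_sq_truncPowIncrement (abs_sub_half_lt_half hH0 hH1))).const_mul _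

theorem setIntegral_Ioc_sq_mandelbrotVanNessKernel (hH0 : 0 < H) (hH1 : H < 1) :
    ∫ s in Set.Ioc (0 : ℝ) 1, mandelbrotVanNessKernel H s ^ 2 = sigmaSq H := by
  have := sigmaSq_pos hH0 hH1
  simp only [mandelbrotVanNessKernel, mul_pow]
  rw [integral_const_mul, setIntegral_Ioc_sq_truncPowIncrement (by linarith),
    Real.sq_sqrt (by positivity)]
  field_simp
  ring

theorem movingAverageAutocov_mandelbrotVanNessKernel (hH0 : 0 < H) (hH1 : H < 1) :
    movingAverageAutocov (mandelbrotVanNessKernel H) = noiseAutocov H := by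
  have sigmaSq_pos := sigmaSq_pos hH0 hH1
  ext k
  have kernel_mul_kernel (s : ℝ) :
      mandelbrotVanNessKernel H s * mandelbrotVanNessKernel H (s + k) =
        2 * H * sigmaSq H *
          ((truncPow (H - 1 / 2) (s - 0) - truncPow (H - 1 / 2) (s - 1)) *
            (truncPow (H - 1 / 2) (s - -k) - truncPow (H - 1 / 2) (s - (1 - k)))) := by
    rw [mandelbrotVanNessKernel, mandelbrotVanNessKernel, mul_mul_mul_comm,
      Real.mul_self_sqrt (by positivity), truncPowIncrement, truncPowIncrement, sub_zero,
      sub_neg_eq_add, sub_sub_eq_add_sub]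
  simp only [movingAverageAutocov, kernel_mul_kernel]
  rw [integral_const_mul, integral_truncPow_sub_mul_truncPow_sub (abs_sub_half_lt_half hH0 hH1),
    integral_sq_truncPowIncrement_sub_half hH0 hH1, mul_left_comm, mul_inv_cancel₀ (by positivity),
    noiseAutocov, show 2 * (H - 1 / 2) + 1 = 2 * H by ring, show 0 - (1 - (k : ℝ)) = k - 1 by ring,
    show 1 - -(k : ℝ) = k + 1 by ring, show 0 - -(k : ℝ) = k by ring,
    show 1 - (1 - (k : ℝ)) = k by ring]
  ring

theorem posDef_toeplitz_noiseAutocov (hH0 : 0 < H) (hH1 : H < 1) (n : ℕ) :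
    (toeplitz (noiseAutocov H) n).PosDef := by
  rw [← movingAverageAutocov_mandelbrotVanNessKernel hH0 hH1]
  refine posDef_toeplitz_movingAverageAutocov (memLp_mandelbrotVanNessKernel hH0 hH1)
    (fun _ => mandelbrotVanNessKernel_of_nonpos H) ?_ n
  rw [setIntegral_Ioc_sq_mandelbrotVanNessKernel hH0 hH1]
  exact sigmaSq_pos hH0 hH1

theorem sigmaSq_le_innovationVariance_noiseAutocov (hH0 : 0 < H) (hH1 : H < 1) (n : ℕ) :
    sigmaSq H ≤ innovationVariance (noiseAutocov H) n := by
  have setIntegral_eq := setIntegral_Ioc_sq_mandelbrotVanNessKernel hH0 hH1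
  rw [← movingAverageAutocov_mandelbrotVanNessKernel hH0 hH1, ← setIntegral_eq]
  exact setIntegral_sq_le_innovationVariance (memLp_mandelbrotVanNessKernel hH0 hH1)
    (fun _ => mandelbrotVanNessKernel_of_nonpos H) (setIntegral_eq ▸ sigmaSq_pos hH0 hH1) n

end MandelbrotVanNess

section Entropy

open scoped Matrix

theorem measurable_mulVec {ι κ : Type*} [Finite ι] [Fintype κ] (A : Matrix ι κ ℝ) :
    Measurable fun x => A *ᵥ x :=
  (Continuous.matrix_mulVec continuous_const continuous_id).measurable

theorem map_mulVec_withDensity {ι : Type*} [Fintype ι] [DecidableEq ι] {A : Matrix ι ι ℝ}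
    (hA : A.det ≠ 0) {f : (ι → ℝ) → ENNReal} (hf : Measurable f) :
    (volume.withDensity f).map (A *ᵥ ·) =
      volume.withDensity fun x => ENNReal.ofReal |A.det|⁻¹ * f (A⁻¹ *ᵥ x) := by
  have map_volume : volume.map (A *ᵥ ·) = ENNReal.ofReal |A.det|⁻¹ • volume := by
    rw [← abs_inv, ← Real.map_matrix_volume_pi_eq_smul_volume_pi hA]
    rfl
  have inv_mulVec_mulVec (x : ι → ℝ) : A⁻¹ *ᵥ A *ᵥ x = x := by
    rw [Matrix.mulVec_mulVec, Matrix.nonsing_inv_mul A (isUnit_iff_ne_zero.2 hA),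
      Matrix.one_mulVec]
  have measurable_comp_inv : Measurable fun x => f (A⁻¹ *ᵥ x) := hf.comp (measurable_mulVec A⁻¹)
  ext s hs
  rw [Measure.map_apply (measurable_mulVec A) hs, withDensity_apply _ (measurable_mulVec A hs),
    withDensity_apply _ hs, lintegral_const_mul _ measurable_comp_inv, ← smul_eq_mul,
    ← lintegral_smul_measure, ← Measure.restrict_smul, ← map_volume,
    setLIntegral_map hs measurable_comp_inv (measurable_mulVec A)]
  simp only [inv_mulVec_mulVec]

variable {Ω : Type*} [MeasurableSpace Ω] {P : Measure Ω} {n : ℕ} {ξ : Ω → Fin n → ℝ}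

theorem measurable_realDensity (ξ : Ω → Fin n → ℝ) (P : Measure Ω) :
    Measurable (realDensity ξ P) :=
  (measurable_pdf ξ P volume).ennreal_toReal

theorem measurable_const_mul_realDensity_comp_mulVec (c : ℝ)
    (A : Matrix (Fin n) (Fin n) ℝ) :
    Measurable fun x => c * realDensity ξ P (A *ᵥ x) :=
  ((measurable_realDensity ξ P).comp (measurable_mulVec A)).const_mul c

theorem aestronglyMeasurable_log_realDensity (ξ : Ω → Fin n → ℝ) (P : Measure Ω) :
    AEStronglyMeasurable (fun x => Real.log (realDensity ξ P x)) volume :=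
  (Real.measurable_log.comp (measurable_realDensity ξ P)).aestronglyMeasurable

variable (P ξ) in
theorem ae_comp_of_ae_volume [HasPDF ξ P volume] {p : (Fin n → ℝ) → Prop}
    (hp : ∀ᵐ x ∂(volume : Measure (Fin n → ℝ)), p x) : ∀ᵐ ω ∂P, p (ξ ω) :=
  ae_of_ae_map (HasPDF.aemeasurable ξ P volume) (HasPDF.absolutelyContinuous.ae_le hp)

section IsFiniteMeasure

variable [IsFiniteMeasure P]

theorem realDensity_ae_eq [HasPDF ξ P volume] {r : (Fin n → ℝ) → ℝ} (hr : Measurable r)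
    (hr0 : 0 ≤ r) (h : P.map ξ = volume.withDensity fun x => ENNReal.ofReal (r x)) :
    realDensity ξ P =ᵐ[volume] r := by
  filter_upwards [(pdf.eq_of_map_eq_withDensity _ hr.ennreal_ofReal.aemeasurable).1 h] with x hx
  rw [realDensity, hx, ENNReal.toReal_ofReal (hr0 x)]

theorem hasEntropy_iff_integrable_log [HasPDF ξ P volume] :
    HasEntropy ξ P ↔ Integrable (fun ω => Real.log (realDensity ξ P (ξ ω))) P :=
  (and_iff_right ‹HasPDF ξ P volume›).trans
    (pdf.integrable_pdf_smul_iff (aestronglyMeasurable_log_realDensity ξ P))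

theorem entropy_eq_neg_integral_log [HasPDF ξ P volume] :
    entropy ξ P = -∫ ω, Real.log (realDensity ξ P (ξ ω)) ∂P :=
  congrArg Neg.neg (pdf.integral_pdf_smul (aestronglyMeasurable_log_realDensity ξ P))

variable (P ξ) in
theorem ae_realDensity_ne_zero [HasPDF ξ P volume] : ∀ᵐ ω ∂P, realDensity ξ P (ξ ω) ≠ 0 := by
  refine ae_of_ae_map (p := fun x => realDensity ξ P x ≠ 0) (HasPDF.aemeasurable ξ P volume) ?_
  rw [map_eq_withDensity_pdf ξ P volume, ae_withDensity_iff (measurable_pdf ξ P volume)]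
  have pdf_lt_top : ∀ᵐ x, pdf ξ P volume x < ⊤ := pdf.ae_lt_top
  filter_upwards [pdf_lt_top] with x hx hx0
  exact ENNReal.toReal_ne_zero.2 ⟨hx0, hx.ne⟩

variable {A : Matrix (Fin n) (Fin n) ℝ}

theorem map_mulVec_eq_withDensity (hA : A.det ≠ 0) [HasPDF ξ P volume] :
    P.map (fun ω => A *ᵥ ξ ω) =
      volume.withDensity fun x => ENNReal.ofReal (|A.det|⁻¹ * realDensity ξ P (A⁻¹ *ᵥ x)) := by
  have ofReal_realDensity_ae_eq :
      (fun x => ENNReal.ofReal (realDensity ξ P x)) =ᵐ[volume] pdf ξ P volume :=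
    pdf.ofReal_toReal_ae_eq
  rw [← Function.comp_def (A *ᵥ ·) ξ, ← AEMeasurable.map_map_of_aemeasurable
      (measurable_mulVec A).aemeasurable (HasPDF.aemeasurable ξ P volume),
    map_eq_withDensity_pdf ξ P volume, ← withDensity_congr_ae ofReal_realDensity_ae_eq,
    map_mulVec_withDensity hA (measurable_realDensity ξ P).ennreal_ofReal]
  simp only [ENNReal.ofReal_mul (inv_nonneg.2 (abs_nonneg A.det))]

theorem hasPDF_mulVec (hA : A.det ≠ 0) [HasPDF ξ P volume] :
    HasPDF (fun ω => A *ᵥ ξ ω) P volume :=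
  hasPDF_of_map_eq_withDensity
    ((measurable_mulVec A).comp_aemeasurable (HasPDF.aemeasurable ξ P volume)) _
    (measurable_const_mul_realDensity_comp_mulVec _ _).ennreal_ofReal.aemeasurable
    (map_mulVec_eq_withDensity hA)

theorem log_realDensity_mulVec_ae_eq (hA : A.det ≠ 0) [HasPDF ξ P volume] :
    (fun ω => Real.log (realDensity (fun ω => A *ᵥ ξ ω) P (A *ᵥ ξ ω))) =ᵐ[P]
      fun ω => Real.log (realDensity ξ P (ξ ω)) - Real.log |A.det| := by
  have := hasPDF_mulVec (P := P) (ξ := ξ) hA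
  have realDensity_mulVec := realDensity_ae_eq
    (measurable_const_mul_realDensity_comp_mulVec _ _)
    (fun _ => mul_nonneg (inv_nonneg.2 (abs_nonneg _)) ENNReal.toReal_nonneg)
    (map_mulVec_eq_withDensity (P := P) (ξ := ξ) hA)
  filter_upwards [ae_comp_of_ae_volume P (fun ω => A *ᵥ ξ ω) realDensity_mulVec,
    ae_realDensity_ne_zero P ξ] with ω density_eq density_ne_zero
  rw [density_eq, Matrix.mulVec_mulVec, Matrix.nonsing_inv_mul A (isUnit_iff_ne_zero.2 hA),
    Matrix.one_mulVec, Real.log_mul (inv_ne_zero (abs_ne_zero.2 hA)) density_ne_zero,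
    Real.log_inv, neg_add_eq_sub]

theorem HasEntropy.mulVec (hA : A.det ≠ 0) (hξ : HasEntropy ξ P) :
    HasEntropy (fun ω => A *ᵥ ξ ω) P := by
  have := hξ.1
  have := hasPDF_mulVec (P := P) (ξ := ξ) hA
  rw [hasEntropy_iff_integrable_log, integrable_congr (log_realDensity_mulVec_ae_eq hA)]
  exact (hasEntropy_iff_integrable_log.1 hξ).sub (integrable_const _)

end IsFiniteMeasure

theorem entropy_mulVec [IsProbabilityMeasure P] {A : Matrix (Fin n) (Fin n) ℝ} (hA : A.det ≠ 0)
    (hξ : HasEntropy ξ P) :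
    entropy (fun ω => A *ᵥ ξ ω) P = entropy ξ P + Real.log |A.det| := by
  have := hξ.1
  have := hasPDF_mulVec (P := P) (ξ := ξ) hA
  rw [entropy_eq_neg_integral_log, integral_congr_ae (log_realDensity_mulVec_ae_eq hA),
    integral_sub (hasEntropy_iff_integrable_log.1 hξ) (integrable_const _), integral_const,
    probReal_univ, one_smul, neg_sub, entropy_eq_neg_integral_log, sub_eq_neg_add]

end Entropy

section GaussianEntropy

open scoped Matrix

theorem pi_withDensity_ofReal {ι : Type*} [Fintype ι] {E : ι → Type*}
    [∀ i, MeasurableSpace (E i)] {μ : ∀ i, Measure (E i)} [∀ i, SigmaFinite (μ i)]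
    {f : ∀ i, E i → ℝ} (hf : ∀ i, Integrable (f i) (μ i)) (hf0 : ∀ i, 0 ≤ f i) :
    Measure.pi (fun i => (μ i).withDensity fun x => ENNReal.ofReal (f i x)) =
      (Measure.pi μ).withDensity fun x => ENNReal.ofReal (∏ i, f i (x i)) := by
  have (i : ι) := isFiniteMeasure_withDensity_ofReal (hf i).2
  refine Measure.pi_eq fun s hs => ?_
  rw [withDensity_apply _ (MeasurableSet.univ_pi hs), Measure.restrict_pi_pi,
    ← ofReal_integral_eq_lintegral_ofReal
      (Integrable.fintype_prod_dep fun i => (hf i).restrict)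
      (ae_of_all _ fun x => Finset.prod_nonneg fun i _ => hf0 i (x i)),
    integral_fintype_prod_eq_prod,
    ENNReal.ofReal_prod_of_nonneg fun i _ => integral_nonneg (hf0 i)]
  refine Finset.prod_congr rfl fun i _ => ?_
  rw [withDensity_apply _ (hs i), ofReal_integral_eq_lintegral_ofReal (hf i).restrict
    (ae_of_all _ (hf0 i))]

theorem pi_gaussianReal_eq_withDensity {ι : Type*} [Fintype ι] (m : ι → ℝ) {v : ι → ℝ≥0}
    (hv : ∀ i, v i ≠ 0) :
    Measure.pi (fun i => gaussianReal (m i) (v i)) =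
      volume.withDensity fun x => ENNReal.ofReal (∏ i, gaussianPDFReal (m i) (v i) (x i)) := by
  simp only [gaussianReal_of_var_ne_zero _ (hv _)]
  exact pi_withDensity_ofReal (fun i => integrable_gaussianPDFReal (m i) (v i))
    fun i => gaussianPDFReal_nonneg (m i) (v i)

theorem log_gaussianPDFReal (m : ℝ) {v : ℝ≥0} (hv : v ≠ 0) (x : ℝ) :
    Real.log (gaussianPDFReal m v x) = -(Real.log (2 * Real.pi * v) + (x - m) ^ 2 / v) / 2 := by
  have : 0 < (v : ℝ) := by positivity
  rw [gaussianPDFReal, Real.log_mul (by positivity) (Real.exp_ne_zero _), Real.log_exp,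
    Real.log_inv, Real.log_sqrt (by positivity)]
  ring

open scoped MatrixOrder in
theorem exists_eq_mul_transpose_of_posDef {ι : Type*} [Fintype ι] [DecidableEq ι]
    {S : Matrix ι ι ℝ} (hS : S.PosDef) : ∃ A : Matrix ι ι ℝ, A.det ≠ 0 ∧ S = A * Aᵀ := by
  obtain ⟨B, hB, rfl⟩ :=
    CStarAlgebra.isStrictlyPositive_iff_eq_star_mul_self.1 hS.isStrictlyPositive
  refine ⟨Bᵀ, ?_, ?_⟩
  · rw [Matrix.det_transpose]
    exact ((Matrix.isUnit_iff_isUnit_det B).1 hB).ne_zero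
  · rw [Matrix.transpose_transpose, Matrix.star_eq_conjTranspose,
      Matrix.conjTranspose_eq_transpose_of_trivial]

theorem log_det_mul_transpose {ι : Type*} [Fintype ι] [DecidableEq ι] (A : Matrix ι ι ℝ) :
    Real.log (A * Aᵀ).det = 2 * Real.log |A.det| := by
  rw [Matrix.det_mul, Matrix.det_transpose, ← sq, Real.log_pow, Real.log_abs, Nat.cast_ofNat]

variable {Ω : Type*} [MeasurableSpace Ω] {P : Measure Ω}

theorem hasGaussianLaw_apply {ι : Type*} {X : Ω → ι → ℝ} (hX : HasGaussianLaw X P)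
    (i : ι) : HasGaussianLaw (fun ω => X ω i) P :=
  HasGaussianLaw.eval (X := fun i ω => X ω i) hX i

variable {ι κ : Type*} [Fintype ι]

theorem covariance_mulVec_mulVec [IsFiniteMeasure P] {X : Ω → ι → ℝ}
    (hX : ∀ i, MemLp (fun ω => X ω i) 2 P)
    {S : Matrix ι ι ℝ} (hS : ∀ i j, cov[fun ω => X ω i, fun ω => X ω j; P] = S i j)
    (C : Matrix κ ι ℝ) (i j : κ) :
    cov[fun ω => (C *ᵥ X ω) i, fun ω => (C *ᵥ X ω) j; P] = (C * S * Cᵀ) i j := by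
  simp only [Matrix.mulVec, dotProduct]
  rw [covariance_fun_sum_fun_sum (fun k => (hX k).const_mul _) fun k => (hX k).const_mul _,
    Finset.sum_comm]
  simp only [covariance_const_mul_left, covariance_const_mul_right, hS, Matrix.mul_apply,
    Matrix.transpose_apply, Finset.sum_mul]
  exact Finset.sum_congr rfl fun l _ => Finset.sum_congr rfl fun k _ => by ring

theorem map_eq_pi_gaussianReal_of_covariance_eq_zero {X : Ω → ι → ℝ} (hX : HasGaussianLaw X P)
    (hcov : ∀ i j, i ≠ j → cov[fun ω => X ω i, fun ω => X ω j; P] = 0) :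
    P.map X = Measure.pi fun i =>
      gaussianReal (∫ ω, X ω i ∂P) (Var[fun ω => X ω i; P]).toNNReal := by
  have indep : iIndepFun (fun i ω => X ω i) P :=
    HasGaussianLaw.iIndepFun_of_covariance_eq_zero hX hcov
  have := hX.isProbabilityMeasure
  rw [iIndepFun_iff_map_fun_eq_pi_map fun i => (hasGaussianLaw_apply hX i).aemeasurable] at indep
  simpa only [(hasGaussianLaw_apply hX _).map_eq_gaussianReal] using indep

theorem map_eq_pi_gaussianReal_of_covariance_eq_one [DecidableEq ι] {X : Ω → ι → ℝ}
    (hX : HasGaussianLaw X P)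
    (hcov : ∀ i j, cov[fun ω => X ω i, fun ω => X ω j; P] = (1 : Matrix ι ι ℝ) i j) :
    P.map X = Measure.pi fun i => gaussianReal (∫ ω, X ω i ∂P) 1 := by
  rw [map_eq_pi_gaussianReal_of_covariance_eq_zero hX fun i j hij => by
    rw [hcov, Matrix.one_apply_ne hij]]
  simp only [← covariance_self (hasGaussianLaw_apply hX _).aemeasurable, hcov,
    Matrix.one_apply_eq, Real.toNNReal_one]

variable {n : ℕ} {ξ : Ω → Fin n → ℝ}

section Standard

theorem map_eq_withDensity_of_covariance_eq_one (hξ : HasGaussianLaw ξ P)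
    (hcov : ∀ i j, cov[fun ω => ξ ω i, fun ω => ξ ω j; P] = (1 : Matrix (Fin n) (Fin n) ℝ) i j) :
    P.map ξ = volume.withDensity fun x =>
      ENNReal.ofReal (∏ i, gaussianPDFReal (∫ ω, ξ ω i ∂P) 1 (x i)) := by
  rw [map_eq_pi_gaussianReal_of_covariance_eq_one hξ hcov,
    pi_gaussianReal_eq_withDensity _ fun _ => one_ne_zero]

theorem measurable_prod_gaussianPDFReal (m : ι → ℝ) (v : ι → ℝ≥0) :
    Measurable fun x : ι → ℝ => ∏ i, gaussianPDFReal (m i) (v i) (x i) :=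
  Finset.measurable_fun_prod _ fun i _ =>
    (measurable_gaussianPDFReal (m i) (v i)).comp (measurable_pi_apply i)

theorem hasPDF_of_covariance_eq_one (hξ : HasGaussianLaw ξ P)
    (hcov : ∀ i j, cov[fun ω => ξ ω i, fun ω => ξ ω j; P] = (1 : Matrix (Fin n) (Fin n) ℝ) i j) :
    HasPDF ξ P volume :=
  hasPDF_of_map_eq_withDensity hξ.aemeasurable _
    (measurable_prod_gaussianPDFReal _ _).ennreal_ofReal.aemeasurable
    (map_eq_withDensity_of_covariance_eq_one hξ hcov)

theorem log_realDensity_ae_eq_of_covariance_eq_one (hξ : HasGaussianLaw ξ P)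
    (hcov : ∀ i j, cov[fun ω => ξ ω i, fun ω => ξ ω j; P] = (1 : Matrix (Fin n) (Fin n) ℝ) i j) :
    (fun ω => Real.log (realDensity ξ P (ξ ω))) =ᵐ[P] fun ω =>
      ∑ i, -(Real.log (2 * Real.pi) + (ξ ω i - ∫ ω', ξ ω' i ∂P) ^ 2) / 2 := by
  have := hξ.isProbabilityMeasure
  have := hasPDF_of_covariance_eq_one hξ hcov
  have realDensity_ae := realDensity_ae_eq (measurable_prod_gaussianPDFReal _ _)
    (fun x => Finset.prod_nonneg fun i _ => gaussianPDFReal_nonneg _ _ (x i))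
    (map_eq_withDensity_of_covariance_eq_one hξ hcov)
  filter_upwards [ae_comp_of_ae_volume P ξ realDensity_ae] with ω hω
  rw [hω, Real.log_prod fun i _ => (gaussianPDFReal_pos _ _ _ one_ne_zero).ne']
  simp only [log_gaussianPDFReal _ one_ne_zero, NNReal.coe_one, mul_one, div_one]

theorem integrable_sq_sub_integral_of_hasGaussianLaw {X : Ω → ℝ} (hX : HasGaussianLaw X P) :
    Integrable (fun ω => (X ω - ∫ ω', X ω' ∂P) ^ 2) P :=
  have := hX.isProbabilityMeasure
  (hX.memLp_two.sub (memLp_const _)).integrable_sq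

theorem hasEntropy_of_covariance_eq_one (hξ : HasGaussianLaw ξ P)
    (hcov : ∀ i j, cov[fun ω => ξ ω i, fun ω => ξ ω j; P] = (1 : Matrix (Fin n) (Fin n) ℝ) i j) :
    HasEntropy ξ P := by
  have := hξ.isProbabilityMeasure
  have := hasPDF_of_covariance_eq_one hξ hcov
  rw [hasEntropy_iff_integrable_log,
    integrable_congr (log_realDensity_ae_eq_of_covariance_eq_one hξ hcov)]
  exact integrable_finsetSum _ fun i _ => ((integrable_const _).add
    (integrable_sq_sub_integral_of_hasGaussianLaw (hasGaussianLaw_apply hξ i))).neg.div_const 2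

theorem entropy_of_covariance_eq_one (hξ : HasGaussianLaw ξ P)
    (hcov : ∀ i j, cov[fun ω => ξ ω i, fun ω => ξ ω j; P] = (1 : Matrix (Fin n) (Fin n) ℝ) i j) :
    entropy ξ P = n / 2 * (1 + Real.log (2 * Real.pi)) := by
  have := hξ.isProbabilityMeasure
  have := hasPDF_of_covariance_eq_one hξ hcov
  have integrable_sq (i : Fin n) :=
    integrable_sq_sub_integral_of_hasGaussianLaw (hasGaussianLaw_apply hξ i)
  have integrable_summand (i : Fin n) : Integrable
      (fun ω => -(Real.log (2 * Real.pi) + (ξ ω i - ∫ ω', ξ ω' i ∂P) ^ 2) / 2) P :=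
    ((integrable_const _).add (integrable_sq i)).neg.div_const 2
  have integral_sq (i : Fin n) : ∫ ω, (ξ ω i - ∫ ω', ξ ω' i ∂P) ^ 2 ∂P = 1 := by
    rw [← variance_eq_integral (hasGaussianLaw_apply hξ i).aemeasurable,
      ← covariance_self (hasGaussianLaw_apply hξ i).aemeasurable, hcov, Matrix.one_apply_eq]
  rw [entropy_eq_neg_integral_log,
    integral_congr_ae (log_realDensity_ae_eq_of_covariance_eq_one hξ hcov),
    integral_finsetSum _ fun i _ => integrable_summand i]
  simp only [integral_div, integral_neg, integral_add (integrable_const _) (integrable_sq _),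
    integral_sq, integral_const, probReal_univ, one_smul, Finset.sum_const, Finset.card_univ,
    Fintype.card_fin, nsmul_eq_mul]
  ring

end Standard

theorem exists_mulVec_covariance_eq_one {S : Matrix ι ι ℝ} [DecidableEq ι] {X : Ω → ι → ℝ}
    (hX : HasGaussianLaw X P) (hS : S.PosDef)
    (hcov : ∀ i j, cov[fun ω => X ω i, fun ω => X ω j; P] = S i j) :
    ∃ (A : Matrix ι ι ℝ) (Y : Ω → ι → ℝ), A.det ≠ 0 ∧ S = A * Aᵀ ∧ X = (fun ω => A *ᵥ Y ω) ∧
      HasGaussianLaw Y P ∧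
      ∀ i j, cov[fun ω => Y ω i, fun ω => Y ω j; P] = (1 : Matrix ι ι ℝ) i j := by
  have := hX.isProbabilityMeasure
  obtain ⟨A, hA, rfl⟩ := exists_eq_mul_transpose_of_posDef hS
  have hA' : IsUnit A.det := isUnit_iff_ne_zero.2 hA
  refine ⟨A, fun ω => A⁻¹ *ᵥ X ω, hA, rfl, ?_,
    hX.map_fun (LinearMap.toContinuousLinearMap (Matrix.mulVecLin A⁻¹)), fun i j => ?_⟩
  · simp only [Matrix.mulVec_mulVec, Matrix.mul_nonsing_inv A hA', Matrix.one_mulVec]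
  · rw [covariance_mulVec_mulVec (fun k => (hasGaussianLaw_apply hX k).memLp_two) hcov,
      ← Matrix.mul_assoc, Matrix.nonsing_inv_mul A hA', Matrix.one_mul, ← Matrix.transpose_mul,
      Matrix.nonsing_inv_mul A hA', Matrix.transpose_one]

variable {S : Matrix (Fin n) (Fin n) ℝ}

theorem hasEntropy_of_hasGaussianLaw (hξ : HasGaussianLaw ξ P) (hS : S.PosDef)
    (hcov : ∀ i j, cov[fun ω => ξ ω i, fun ω => ξ ω j; P] = S i j) : HasEntropy ξ P := by
  have := hξ.isProbabilityMeasure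
  obtain ⟨A, η, hA, -, rfl, hη, cov_η⟩ := exists_mulVec_covariance_eq_one hξ hS hcov
  exact (hasEntropy_of_covariance_eq_one hη cov_η).mulVec hA

theorem entropy_of_hasGaussianLaw (hξ : HasGaussianLaw ξ P) (hS : S.PosDef)
    (hcov : ∀ i j, cov[fun ω => ξ ω i, fun ω => ξ ω j; P] = S i j) :
    entropy ξ P = n / 2 * (1 + Real.log (2 * Real.pi)) + Real.log S.det / 2 := by
  have := hξ.isProbabilityMeasure
  obtain ⟨A, η, hA, rfl, rfl, hη, cov_η⟩ := exists_mulVec_covariance_eq_one hξ hS hcov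
  rw [entropy_mulVec hA (hasEntropy_of_covariance_eq_one hη cov_η),
    entropy_of_covariance_eq_one hη cov_η, log_det_mul_transpose,
    mul_div_cancel_left₀ _ two_ne_zero]

end GaussianEntropy

section FractionalGaussianNoise

variable {Ω : Type*} [MeasurableSpace Ω] {P : Measure Ω} {B : ℝ≥0 → Ω → ℝ}

theorem hasGaussianLaw_initialVector_fractionalGaussianNoise (hB : IsGaussianProcess B P) (n : ℕ) :
    HasGaussianLaw (initialVector (fractionalGaussianNoise B) n) P := by
  have hasGaussianLaw_increments :=
    hB.hasGaussianLaw_increments (n := n) (t := fun i : Fin (n + 1) => ((i : ℕ) : ℝ≥0))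
  convert! hasGaussianLaw_increments using 3
  simp only [initialVector, fractionalGaussianNoise, Fin.val_succ, Fin.val_castSucc, Nat.cast_add,
    Nat.cast_one]

variable {H : ℝ}

theorem covariance_fractionalBrownianMotion (hB : IsFractionalBrownianMotion H B P) (t s : ℝ≥0) :
    cov[B t, B s; P] =
      1 / 2 * ((t : ℝ) ^ (2 * H) + (s : ℝ) ^ (2 * H) - |(t : ℝ) - (s : ℝ)| ^ (2 * H)) := by
  have memLp_two (t : ℝ≥0) : MemLp (B t) 2 P :=
    (hB.isGaussianProcess.hasGaussianLaw_eval t).memLp_two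
  have := (hB.isGaussianProcess.hasGaussianLaw_eval t).isProbabilityMeasure
  rw [covariance_eq_sub (memLp_two t) (memLp_two s), hB.centered, zero_mul, sub_zero,
    ← hB.covariance]
  rfl

theorem covariance_fractionalGaussianNoise (hB : IsFractionalBrownianMotion H B P) (j k : ℕ) :
    cov[fractionalGaussianNoise B j, fractionalGaussianNoise B k; P] =
      noiseAutocov H ((j : ℤ) - k) := by
  have memLp_two (t : ℝ≥0) : MemLp (B t) 2 P :=
    (hB.isGaussianProcess.hasGaussianLaw_eval t).memLp_two
  have := (hB.isGaussianProcess.hasGaussianLaw_eval 0).isProbabilityMeasure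
  rw [show fractionalGaussianNoise B j = fun ω => B (j + 1) ω - B j ω from rfl,
    show fractionalGaussianNoise B k = fun ω => B (k + 1) ω - B k ω from rfl,
    covariance_fun_sub_fun_sub (memLp_two _) (memLp_two _) (memLp_two _) (memLp_two _)]
  simp only [covariance_fractionalBrownianMotion hB, noiseAutocov]
  push_cast
  rw [show (j : ℝ) + 1 - (k + 1) = j - k by ring, show (j : ℝ) + 1 - k = j - k + 1 by ring,
    show (j : ℝ) - (k + 1) = j - k - 1 by ring]
  ring

theorem hasEntropy_fractionalGaussianNoise (hH0 : 0 < H) (hH1 : H < 1)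
    (hB : IsFractionalBrownianMotion H B P) (n : ℕ) :
    HasEntropy (initialVector (fractionalGaussianNoise B) n) P :=
  hasEntropy_of_hasGaussianLaw
    (hasGaussianLaw_initialVector_fractionalGaussianNoise hB.isGaussianProcess n)
    (posDef_toeplitz_noiseAutocov hH0 hH1 n)
    fun i j => covariance_fractionalGaussianNoise hB i j

theorem entropy_fractionalGaussianNoise (hH0 : 0 < H) (hH1 : H < 1)
    (hB : IsFractionalBrownianMotion H B P) (n : ℕ) :
    entropy (initialVector (fractionalGaussianNoise B) n) P =
      n / 2 * (1 + Real.log (2 * Real.pi)) + Real.log (toeplitz (noiseAutocov H) n).det / 2 :=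
  entropy_of_hasGaussianLaw
    (hasGaussianLaw_initialVector_fractionalGaussianNoise hB.isGaussianProcess n)
    (posDef_toeplitz_noiseAutocov hH0 hH1 n)
    fun i j => covariance_fractionalGaussianNoise hB i j

end FractionalGaussianNoise

theorem mainTheorem2 {Ω : Type*} [MeasurableSpace Ω] (P : Measure Ω)
    (H : ℝ) (hH0 : 0 < H) (hH1 : H < 1)
    (B : ℝ≥0 → Ω → ℝ) (hB : IsFractionalBrownianMotion H B P) :
    (∀ n : ℕ, 1 ≤ n →
      HasEntropy (initialVector (fractionalGaussianNoise B) n) P ∧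
      entropy (initialVector (fractionalGaussianNoise B) n) P ≥
        (n : ℝ) / 2 * (1 + Real.log (2 * Real.pi) + Real.log (sigmaSq H))) ∧
    ∃ h : ℝ, IsEntropyRate (fractionalGaussianNoise B) P h ∧
      h ≥ (1 + Real.log (2 * Real.pi)) / 2 + Real.log (sigma H) := by
  have hasEntropy := hasEntropy_fractionalGaussianNoise hH0 hH1 hB
  have entropy_eq := entropy_fractionalGaussianNoise hH0 hH1 hB
  have posDef := posDef_toeplitz_noiseAutocov hH0 hH1
  have sigmaSq_pos := sigmaSq_pos hH0 hH1
  have sigmaSq_le := sigmaSq_le_innovationVariance_noiseAutocov hH0 hH1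
  refine ⟨fun n _ => ⟨hasEntropy n, ?_⟩, ?_⟩
  · rw [entropy_eq]
    linarith [mul_log_le_log_det_toeplitz posDef sigmaSq_pos sigmaSq_le n]
  · obtain ⟨l, log_sigmaSq_le, tendsto_log_det_div⟩ :=
      exists_tendsto_log_det_toeplitz_div posDef sigmaSq_pos sigmaSq_le
    refine ⟨(1 + Real.log (2 * Real.pi)) / 2 + l / 2, ⟨fun n _ => hasEntropy n, ?_⟩, ?_⟩
    · refine ((tendsto_log_det_div.div_const 2).const_add _).congr' ?_
      filter_upwards [eventually_ne_atTop 0] with n hn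
      rw [entropy_eq]
      field_simp
    · rw [sigma, Real.log_sqrt sigmaSq_pos.le]
      linarith
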